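/- A lattice equable parallelogram (LEP) is a nondegenerate parallelogram in the Euclidean plane whose vertices lie on $\mathbb Z^2$ and whose perimeter equals its area. A LEP $P$ is called Pythagorean if there is a rectangle $R$ (not necessarily with sides parallel to the axes) with integer side lengths such that every vertex of $P$ lies on a side of $R$, and $P$ and $R$ have a common diagonal ($R=P$ is allowed). **Theorem.** If a Pythagorean LEP has side lengths $a\le b$, then $a\in\{3,4,5,6,10\}$. Moreover, real numbers $a\le b$ are the side lengths of a Pythagorean LEP if and only if $(a,b)$ belongs to one of the following five families, where $x,y$ are integers: - (F1) $a=3$, $b=\frac{3(x^2+y^2)}{2}$, where $y^2-5x^2=4$; - (F2) $a=4$, $b=4(x^2+y^2)$, where $y^2-3x^2=1$; - (F3) $a=5$, $b=\frac{x^2+y^2}{2}$, where $3y^2-7x^2=20$; - (F4) $a=6$, $b=3(x^2+y^2)$, where $y^2-2x^2=1$; - (F5) $a=10$, $b=x^2+y^2$, where $2y^2-3x^2=5$. Every integer solution $(x,y)$ of each of these equations gives a pair $(a,b)$ of side lengths of a Pythagorean LEP (where $a>b$ can occur: the smallest solutions in (F4) and (F5) give $(6,3)$ and $(10,5)$), and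 each of the five families contains infinitely many pairs $(a,b)$ with $a\le b$. -/

import Mathlib

/-- The Euclidean plane. -/
abbrev Plane : Type := EuclideanSpace ℝ (Fin 2)

/-- `P 0, P 1, P 2, P 3` are, in cyclic order, the vertices of a (nondegenerate) parallelogram.
Indices in `Fin 4` are read modulo `4`. -/
def IsParallelogram (P : Fin 4 → Plane) : Prop :=
  P 1 - P 0 = P 2 - P 3 ∧ LinearIndependent ℝ ![P 1 - P 0, P 3 - P 0]

/-- A rectangle: a parallelogram with a right angle. -/
def IsRectangle (R : Fin 4 → Plane) : Prop :=
  IsParallelogram R ∧ inner ℝ (R 1 - R 0) (R 3 - R 0) = 0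

/-- The perimeter of the quadrilateral with the given vertices in cyclic order. -/
noncomputable def perimeter (P : Fin 4 → Plane) : ℝ :=
  ∑ i, dist (P i) (P (i + 1))

/-- The area (Lebesgue measure) of the convex quadrilateral with the given vertices. -/
noncomputable def area (P : Fin 4 → Plane) : ℝ :=
  MeasureTheory.volume.real (convexHull ℝ (Set.range P))

/-- A lattice equable parallelogram (LEP): a parallelogram whose perimeter equals its area and
whose vertices lie on the integer lattice. -/
def IsLEP (P : Fin 4 → Plane) : Prop :=
  IsParallelogram P ∧ (∀ i j, ∃ n : ℤ, P i j = n) ∧ perimeter P = area P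

/-- The rectangle (or quadrilateral) `R` circumscribes `P`: every vertex of `P` lies on a side
of `R`. -/
def Circumscribes (R P : Fin 4 → Plane) : Prop :=
  ∀ i, ∃ j, P i ∈ segment ℝ (R j) (R (j + 1))

/-- `R` and `P` have a diagonal in common. -/
def ShareDiagonal (R P : Fin 4 → Plane) : Prop :=
  ∃ i j, P i = R j ∧ P (i + 2) = R (j + 2)

/-- A Pythagorean equable parallelogram: a LEP circumscribed by a rectangle (in any position)
having integer side lengths, so that the rectangle and the parallelogram share a diagonal. -/
def IsPythagoreanLEP (P : Fin 4 → Plane) : Prop :=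
  IsLEP P ∧ ∃ R : Fin 4 → Plane, IsRectangle R ∧
    (∀ j, ∃ n : ℤ, dist (R j) (R (j + 1)) = n) ∧ Circumscribes R P ∧ ShareDiagonal R P

/-- The (unordered) pair of side lengths of the parallelogram `P` is `a, b`. -/
def HasSides (P : Fin 4 → Plane) (a b : ℝ) : Prop :=
  (dist (P 0) (P 1) = a ∧ dist (P 1) (P 2) = b) ∨
    (dist (P 0) (P 1) = b ∧ dist (P 1) (P 2) = a)

/-- The pairs `(a, b)` that are the side lengths, in some order, of a Pythagorean equable
parallelogram. -/
def pythagoreanSides : Set (ℝ × ℝ) :=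
  {p | ∃ P : Fin 4 → Plane, IsPythagoreanLEP P ∧ HasSides P p.1 p.2}

def family1 : Set (ℝ × ℝ) :=
  {p | ∃ x y : ℤ, y ^ 2 - 5 * x ^ 2 = 4 ∧ p.1 = 3 ∧ p.2 = 3 * ((x : ℝ) ^ 2 + (y : ℝ) ^ 2) / 2}

def family2 : Set (ℝ × ℝ) :=
  {p | ∃ x y : ℤ, y ^ 2 - 3 * x ^ 2 = 1 ∧ p.1 = 4 ∧ p.2 = 4 * ((x : ℝ) ^ 2 + (y : ℝ) ^ 2)}

def family3 : Set (ℝ × ℝ) :=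
  {p | ∃ x y : ℤ, 3 * y ^ 2 - 7 * x ^ 2 = 20 ∧ p.1 = 5 ∧ p.2 = ((x : ℝ) ^ 2 + (y : ℝ) ^ 2) / 2}

def family4 : Set (ℝ × ℝ) :=
  {p | ∃ x y : ℤ, y ^ 2 - 2 * x ^ 2 = 1 ∧ p.1 = 6 ∧ p.2 = 3 * ((x : ℝ) ^ 2 + (y : ℝ) ^ 2)}

def family5 : Set (ℝ × ℝ) :=
  {p | ∃ x y : ℤ, 2 * y ^ 2 - 3 * x ^ 2 = 5 ∧ p.1 = 10 ∧ p.2 = (x : ℝ) ^ 2 + (y : ℝ) ^ 2}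

/-!
If a vertex of a Pythagorean LEP lies on a side of the rectangle and the diagonal is shared, then
one side of the LEP, of length `t` say, lies along a side of the rectangle. The height `h` over it
and the projection `s` of the other side, of length `c`, are therefore integers: `(s, h, c)` is a
Pythagorean triple with `t h = 2 (t + c)`. Parametrizing the triple by `h = d p q` and
`2 c = d (p ^ 2 + q ^ 2)` turns this into `d (t p q - p ^ 2 - q ^ 2) = 2 t`. Vieta jumping in `p, q`
leaves `t` and `d` fixed and reaches a solution so small that only finitely many `(t, d)` survive;
for each of them the equation is one of the five equations of Pell type, in the variables
`q - p` and `q + p`.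
-/

/-- `t` and `c` are the side lengths of an equable parallelogram for which the height `h` over the
side `t`, and the orthogonal projection `s` of the side `c` to the side `t`, are integers: the
area `t h` equals the perimeter `2 (t + c)`. -/
def IsBaseSidePair (t c : ℤ) : Prop :=
  0 < t ∧ 0 < c ∧ ∃ s h : ℤ, PythagoreanTriple s h c ∧ t * h = 2 * (t + c)

theorem exists_eq_mul_mul_of_pythagoreanTriple {s h c : ℤ} (hs : PythagoreanTriple s h c)
    (hh : 0 < h) (hc : 0 < c) :
    ∃ d p q : ℤ, 0 < d ∧ 0 < p ∧ 0 < q ∧ h = d * p * q ∧ 2 * c = d * (p ^ 2 + q ^ 2) := by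
  obtain ⟨d, p, q, hhd, hcd⟩ : ∃ d p q : ℤ, h = d * p * q ∧ 2 * c = d * (p ^ 2 + q ^ 2) := by
    obtain ⟨k, m, n, ⟨-, rfl⟩ | ⟨-, rfl⟩, rfl | rfl⟩ := PythagoreanTriple.classification.1 hs
    · exact ⟨2 * k, m, n, by ring, by ring⟩
    · exact ⟨-(2 * k), m, -n, by ring, by ring⟩
    · exact ⟨k, m - n, m + n, by ring, by ring⟩
    · exact ⟨-k, m - n, -(m + n), by ring, by ring⟩
  have hd : 0 < d := pos_of_mul_pos_left (by rw [← hcd]; positivity) (by positivity)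
  have hpq : 0 < p * q := pos_of_mul_pos_right (by rwa [← mul_assoc, ← hhd]) hd.le
  refine ⟨d, |p|, |q|, hd, abs_pos.2 (left_ne_zero_of_mul hpq.ne'),
    abs_pos.2 (right_ne_zero_of_mul hpq.ne'), ?_, by rwa [sq_abs, sq_abs]⟩
  rw [mul_assoc, ← abs_mul, abs_of_pos hpq, hhd, mul_assoc]

-- Vieta jumping: `t p - q` is the other root of the equation, read as a quadratic in `q`.
theorem exists_reduced_solution {t N p q : ℤ} (hN : 0 ≤ N) (hp : 0 < p) (hq : 0 < q)
    (h : t * p * q - p ^ 2 - q ^ 2 = N) :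
    ∃ p' q' : ℤ, 0 < p' ∧ p' ≤ q' ∧ 2 * q' ≤ t * p' ∧ t * p' * q' - p' ^ 2 - q' ^ 2 = N := by
  induction hn : (p + q).toNat using Nat.strong_induction_on generalizing p q with
  | _ n ih =>
    wlog hpq : p ≤ q generalizing p q
    · exact this hq hp (by linear_combination h) (by rwa [add_comm]) (le_of_not_ge hpq)
    by_cases hred : 2 * q ≤ t * p
    · exact ⟨p, q, hp, hpq, hred, h⟩
    have hjump : q * (t * p - q) = p ^ 2 + N := by linear_combination h
    have hpos : 0 < t * p - q := pos_of_mul_pos_right (hjump ▸ by positivity) hq.le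
    exact ih _ (by omega) hp hpos (by linear_combination h) rfl

theorem eq_and_eq_of_reduced_solution {t d p q : ℤ} (ht : 0 < t) (hd : 0 < d) (hp : 0 < p)
    (hpq : p ≤ q) (hred : 2 * q ≤ t * p) (h : d * (t * p * q - p ^ 2 - q ^ 2) = 2 * t) :
    t = 3 ∧ d = 6 ∨ t = 4 ∧ (d = 1 ∨ d = 4) ∨ t = 5 ∧ d = 2 ∨ t = 6 ∧ d = 3 ∨ t = 10 ∧ d = 1 := by
  have ht3 : 3 ≤ t := by
    have ht2 : 2 ≤ t := by nlinarith
    by_contra! hlt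
    obtain rfl : t = 2 := by omega
    obtain rfl : p = q := by omega
    linarith
  have hform : (t - 2) * p ^ 2 ≤ t * p * q - p ^ 2 - q ^ 2 := by
    nlinarith [mul_nonneg (sub_nonneg.2 hpq) (by nlinarith : 0 ≤ t * p - p - q)]
  have hdp : d * p ^ 2 ≤ 6 := by
    have : (t - 2) * (d * p ^ 2) ≤ (t - 2) * 6 := by nlinarith
    exact le_of_mul_le_mul_left this (by omega)
  have hlin : t * (d * p * q - 2) = d * (p ^ 2 + q ^ 2) := by linear_combination h
  have hq : q * (d * p * q - 4) ≤ d * p ^ 3 := by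
    have hpos : 0 < d * p * q - 2 :=
      pos_of_mul_pos_right (hlin ▸ mul_pos hd (by positivity)) ht.le
    nlinarith [mul_le_mul_of_nonneg_right hred hpos.le]
  have hp2 : p ≤ 2 := by nlinarith
  have hd6 : d ≤ 6 := by nlinarith
  have hq4 : q ≤ 4 := by
    by_contra! hlt
    have : 5 * p ≤ p * q := by nlinarith
    interval_cases p <;> nlinarith
  clear h hform hred
  interval_cases p <;> interval_cases d <;> interval_cases q <;> omega

theorem even_and_even_of_four_dvd_sq_add_sq {p q : ℤ} (h : 4 ∣ p ^ 2 + q ^ 2) :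
    Even p ∧ Even q := by
  obtain ⟨k, rfl | rfl⟩ := p.even_or_odd' <;> obtain ⟨l, rfl | rfl⟩ := q.even_or_odd' <;> grind

theorem IsBaseSidePair.exists_solution {t c : ℤ} (h : IsBaseSidePair t c) :
    ∃ d p q : ℤ, (t = 3 ∧ d = 6 ∨ t = 4 ∧ d = 4 ∨ t = 5 ∧ d = 2 ∨ t = 6 ∧ d = 3 ∨
      t = 10 ∧ d = 1) ∧ d * (t * p * q - p ^ 2 - q ^ 2) = 2 * t ∧ 2 * c = d * (p ^ 2 + q ^ 2) := by
  obtain ⟨ht, hc, s, h, hs, harea⟩ := h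
  have hh : 0 < h := pos_of_mul_pos_right (by rw [harea]; positivity) ht.le
  obtain ⟨d, p, q, hd, hp, hq, rfl, hcd⟩ := exists_eq_mul_mul_of_pythagoreanTriple hs hh hc
  have hN : d * (t * p * q - p ^ 2 - q ^ 2) = 2 * t := by linear_combination harea + hcd
  have hN₀ : 0 < t * p * q - p ^ 2 - q ^ 2 :=
    pos_of_mul_pos_right (by rw [hN]; positivity) hd.le
  obtain ⟨p', q', hp', hpq', hred, heq⟩ := exists_reduced_solution hN₀.le hp hq rfl
  rcases eq_and_eq_of_reduced_solution ht hd hp' hpq' hred (heq ▸ hN) with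
    h₃ | ⟨rfl, rfl | rfl⟩ | h₅
  · exact ⟨d, p, q, .inl h₃, hN, hcd⟩
  · obtain ⟨⟨k, rfl⟩, ⟨l, rfl⟩⟩ := even_and_even_of_four_dvd_sq_add_sq
      (⟨p * q - 2, by linarith⟩ : 4 ∣ p ^ 2 + q ^ 2)
    exact ⟨4, k, l, .inr <| .inl ⟨rfl, rfl⟩, by linarith, by linarith⟩
  · exact ⟨4, p, q, .inr <| .inl ⟨rfl, rfl⟩, hN, hcd⟩
  · exact ⟨d, p, q, .inr <| .inr h₅, hN, hcd⟩

/-- The union of the five families of side pairs. -/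
def sideFamilies : Set (ℝ × ℝ) :=
  family1 ∪ (family2 ∪ (family3 ∪ (family4 ∪ family5)))

theorem exists_eq_sub_and_eq_add {p q : ℤ} (h : Even (p ^ 2 + q ^ 2)) :
    ∃ x y : ℤ, p = y - x ∧ q = y + x := by
  obtain ⟨y, hy⟩ : Even (p + q) := by simpa [Int.even_add, Int.even_pow] using h
  exact ⟨q - y, y, by omega, by omega⟩

theorem IsBaseSidePair.mem_sideFamilies {t c : ℤ} (h : IsBaseSidePair t c) :
    ((t : ℝ), (c : ℝ)) ∈ sideFamilies := by
  obtain ⟨d, p, q, htd, hN, hc⟩ := h.exists_solution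
  have hcR : (2 * c : ℝ) = d * (p ^ 2 + q ^ 2) := by exact_mod_cast hc
  rcases htd with ⟨rfl, rfl⟩ | ⟨rfl, rfl⟩ | ⟨rfl, rfl⟩ | ⟨rfl, rfl⟩ | ⟨rfl, rfl⟩
  · exact .inl ⟨q - p, q + p, by linarith, rfl, by push_cast at hcR ⊢; linarith⟩
  · obtain ⟨x, y, rfl, rfl⟩ := exists_eq_sub_and_eq_add (p := p) (q := q)
      ⟨2 * p * q - 1, by linarith⟩
    exact .inr <| .inl ⟨x, y, by linarith, rfl, by push_cast at hcR ⊢; linarith⟩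
  · exact .inr <| .inr <| .inl ⟨q - p, q + p, by linarith, rfl, by push_cast at hcR ⊢; linarith⟩
  · obtain ⟨x, y, rfl, rfl⟩ := exists_eq_sub_and_eq_add (p := p) (q := q)
      ⟨3 * p * q - 2, by linarith⟩
    exact .inr <| .inr <| .inr <| .inl ⟨x, y, by linarith, rfl, by push_cast at hcR ⊢; linarith⟩
  · obtain ⟨x, y, rfl, rfl⟩ := exists_eq_sub_and_eq_add (p := p) (q := q) ⟨c, by linarith⟩
    exact .inr <| .inr <| .inr <| .inr ⟨x, y, by linarith, rfl, by push_cast at hcR ⊢; linarith⟩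

theorem isBaseSidePair_of_form {t c E x y : ℤ} (ht : 0 < t) (hE : 0 < E)
    (hxy : E * ((t - 2) * y ^ 2 - (t + 2) * x ^ 2) = 4 * t) (hc : 2 * c = E * (x ^ 2 + y ^ 2)) :
    IsBaseSidePair t c := by
  have hne : x ≠ 0 ∨ y ≠ 0 := by
    by_contra! h
    simp only [h.1, h.2] at hxy
    linarith
  have hpos : 0 < x ^ 2 + y ^ 2 := by rcases hne with h | h <;> positivity
  -- The triple is `E / 2` times `(2 x y, y ^ 2 - x ^ 2, x ^ 2 + y ^ 2)`.
  refine ⟨ht, by linarith [mul_pos hE hpos], E * x * y, c - E * x ^ 2, ?_, ?_⟩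
  · unfold PythagoreanTriple
    linear_combination -E * x ^ 2 * hc
  · exact mul_left_cancel₀ two_ne_zero (by linear_combination (t - 2) * hc + hxy)

theorem exists_isBaseSidePair_of_mem_sideFamilies {a b : ℝ} (h : (a, b) ∈ sideFamilies) :
    ∃ t c : ℤ, a = t ∧ b = c ∧ IsBaseSidePair t c := by
  rcases h with ⟨x, y, h, rfl, rfl⟩ | ⟨x, y, h, rfl, rfl⟩ | ⟨x, y, h, rfl, rfl⟩ |
    ⟨x, y, h, rfl, rfl⟩ | ⟨x, y, h, rfl, rfl⟩
  · have hR : (y : ℝ) ^ 2 - 5 * x ^ 2 = 4 := by exact_mod_cast h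
    exact ⟨3, 9 * x ^ 2 + 6, by norm_num, by push_cast; linarith,
      isBaseSidePair_of_form (E := 3) (x := x) (y := y)
        (by norm_num) (by norm_num) (by linarith) (by linarith)⟩
  · exact ⟨4, 4 * (x ^ 2 + y ^ 2), by norm_num, by push_cast; ring,
      isBaseSidePair_of_form (E := 8) (x := x) (y := y)
        (by norm_num) (by norm_num) (by linarith) (by ring)⟩
  · have hR : 3 * (y : ℝ) ^ 2 - 7 * x ^ 2 = 20 := by exact_mod_cast h
    exact ⟨5, 10 + 4 * x ^ 2 - y ^ 2, by norm_num, by push_cast; linarith,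
      isBaseSidePair_of_form (E := 1) (x := x) (y := y)
        (by norm_num) (by norm_num) (by linarith) (by linarith)⟩
  · exact ⟨6, 3 * (x ^ 2 + y ^ 2), by norm_num, by push_cast; ring,
      isBaseSidePair_of_form (E := 6) (x := x) (y := y)
        (by norm_num) (by norm_num) (by linarith) (by ring)⟩
  · exact ⟨10, x ^ 2 + y ^ 2, by norm_num, by push_cast; ring,
      isBaseSidePair_of_form (E := 2) (x := x) (y := y)
        (by norm_num) (by norm_num) (by linarith) (by ring)⟩

theorem swap_mem_sideFamilies {a b : ℝ} (h : (a, b) ∈ sideFamilies) (hba : b ≤ a) :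
    (b, a) ∈ sideFamilies := by
  rcases h with ⟨x, y, h, rfl, rfl⟩ | ⟨x, y, h, rfl, rfl⟩ | ⟨x, y, h, rfl, rfl⟩ |
    ⟨x, y, h, rfl, rfl⟩ | ⟨x, y, h, rfl, rfl⟩ <;>
  have hR := congrArg (Int.cast : ℤ → ℝ) h <;> push_cast at hR <;>
  have hx₀ := sq_nonneg x
  · linarith [sq_nonneg (x : ℝ)]
  · have hx : x ^ 2 ≤ 0 := by exact_mod_cast (by linarith : (x : ℝ) ^ 2 ≤ 0)
    have hxR : (x : ℝ) ^ 2 = 0 := by exact_mod_cast hx.antisymm hx₀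
    exact .inr <| .inl ⟨0, 1, by norm_num, by linarith, by norm_num⟩
  · have hx : x ^ 2 < 2 := by exact_mod_cast (by linarith : (x : ℝ) ^ 2 < 2)
    have hxR : (x : ℝ) ^ 2 = 1 := by exact_mod_cast (by omega : x ^ 2 = 1)
    exact .inr <| .inr <| .inl ⟨1, 3, by norm_num, by linarith, by norm_num⟩
  · have hx : x ^ 2 < 1 := by exact_mod_cast (by linarith : (x : ℝ) ^ 2 < 1)
    have hxR : (x : ℝ) ^ 2 = 0 := by exact_mod_cast (by omega : x ^ 2 = 0)
    exact .inl ⟨0, 2, by norm_num, by linarith, by norm_num⟩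
  · have hx : x ^ 2 < 4 := by exact_mod_cast (by linarith : (x : ℝ) ^ 2 < 4)
    obtain ⟨hx₁, hx₂⟩ : -2 < x ∧ x < 2 := abs_lt.1 (abs_lt_of_sq_lt_sq hx zero_le_two)
    have hxR : (x : ℝ) ^ 2 = 1 := by
      exact_mod_cast (by interval_cases x <;> omega : x ^ 2 = 1)
    exact .inr <| .inr <| .inl ⟨2, 4, by norm_num, by linarith, by norm_num⟩

/-! ### Infinitude of the families -/

theorem exists_solution_abs_lt {A B C x y : ℤ} (hB : 0 < B) (hC : 0 < C)
    (hsq : ¬IsSquare (A * B)) (h : A * y ^ 2 - B * x ^ 2 = C) :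
    ∃ x' y' : ℤ, |x| < x' ∧ A * y' ^ 2 - B * x' ^ 2 = C := by
  have hAy : 0 < A * y ^ 2 := by nlinarith [sq_nonneg x]
  have hA : 0 < A := pos_of_mul_pos_left hAy (sq_nonneg y)
  have hy : y ≠ 0 := by
    rintro rfl
    simp at hAy
  obtain ⟨u, w, huw, hw⟩ := Pell.exists_of_not_isSquare (mul_pos hA hB) hsq
  have hu : u ≠ 0 := by
    rintro rfl
    nlinarith [mul_pos hA hB, sq_nonneg w]
  -- Multiplication by the unit `|u| + |w| √(A B)` preserves the form and increases `|x|`.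
  refine ⟨|u| * |x| + A * |w| * |y|, |u| * |y| + B * |w| * |x|, ?_, ?_⟩
  · calc |x| ≤ |u| * |x| := le_mul_of_one_le_left (abs_nonneg x) (Int.one_le_abs hu)
      _ < |u| * |x| + A * |w| * |y| := lt_add_of_pos_right _ (by positivity)
  · calc A * (|u| * |y| + B * |w| * |x|) ^ 2 - B * (|u| * |x| + A * |w| * |y|) ^ 2
        = (|u| ^ 2 - A * B * |w| ^ 2) * (A * |y| ^ 2 - B * |x| ^ 2) := by ring
      _ = C := by rw [sq_abs, sq_abs, sq_abs, sq_abs, huw, h, one_mul]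

theorem exists_solution_gt {A B C x₀ y₀ : ℤ} (hB : 0 < B) (hC : 0 < C)
    (hsq : ¬IsSquare (A * B)) (h₀ : A * y₀ ^ 2 - B * x₀ ^ 2 = C) (n : ℕ) :
    ∃ x y : ℤ, n < x ∧ A * y ^ 2 - B * x ^ 2 = C := by
  induction n with
  | zero =>
    obtain ⟨x, y, hx, h⟩ := exists_solution_abs_lt hB hC hsq h₀
    exact ⟨x, y, (abs_nonneg x₀).trans_lt hx, h⟩
  | succ n ih =>
    obtain ⟨x, y, hx, h⟩ := ih
    obtain ⟨x', y', hx', h'⟩ := exists_solution_abs_lt hB hC hsq h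
    exact ⟨x', y', by push_cast; linarith [le_abs_self x], h'⟩

theorem infinite_of_forall_solution_mem {A B C x₀ y₀ : ℤ} {a r : ℝ} {F : Set (ℝ × ℝ)}
    (hB : 0 < B) (hC : 0 < C) (hsq : ¬IsSquare (A * B)) (h₀ : A * y₀ ^ 2 - B * x₀ ^ 2 = C)
    (hr : 0 < r)
    (hF : ∀ x y : ℤ, A * y ^ 2 - B * x ^ 2 = C → (a, r * ((x : ℝ) ^ 2 + (y : ℝ) ^ 2)) ∈ F) :
    {p ∈ F | p.1 ≤ p.2}.Infinite := by
  refine Set.Infinite.of_image Prod.snd (Set.infinite_of_forall_exists_gt fun z => ?_)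
  obtain ⟨n, hn⟩ := exists_nat_gt (max a z / r)
  obtain ⟨x, y, hx, h⟩ := exists_solution_gt hB hC hsq h₀ n
  have hlarge : max a z < r * ((x : ℝ) ^ 2 + (y : ℝ) ^ 2) := by
    have hnx : (n : ℝ) < x := by exact_mod_cast hx
    have hxx : (x : ℝ) ≤ x ^ 2 := by exact_mod_cast Int.le_self_sq x
    rw [← div_lt_iff₀' hr]
    linarith [sq_nonneg (y : ℝ)]
  exact ⟨_, ⟨_, ⟨hF x y h, (le_max_left a z).trans hlarge.le⟩, rfl⟩,
    (le_max_right a z).trans_lt hlarge⟩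

theorem infinite_family1 : {p ∈ family1 | p.1 ≤ p.2}.Infinite :=
  infinite_of_forall_solution_mem (A := 1) (B := 5) (C := 4) (x₀ := 0) (y₀ := 2) (a := 3)
    (r := 3 / 2) (by norm_num) (by norm_num) (by norm_num) (by norm_num) (by norm_num)
    fun x y h => ⟨x, y, by linarith, rfl, by ring⟩

theorem infinite_family2 : {p ∈ family2 | p.1 ≤ p.2}.Infinite :=
  infinite_of_forall_solution_mem (A := 1) (B := 3) (C := 1) (x₀ := 0) (y₀ := 1) (a := 4)
    (r := 4) (by norm_num) (by norm_num) (by norm_num) (by norm_num) (by norm_num)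
    fun x y h => ⟨x, y, by linarith, rfl, rfl⟩

theorem infinite_family3 : {p ∈ family3 | p.1 ≤ p.2}.Infinite :=
  infinite_of_forall_solution_mem (A := 3) (B := 7) (C := 20) (x₀ := 1) (y₀ := 3) (a := 5)
    (r := 1 / 2) (by norm_num) (by norm_num) (by norm_num) (by norm_num) (by norm_num)
    fun x y h => ⟨x, y, h, rfl, by ring⟩

theorem infinite_family4 : {p ∈ family4 | p.1 ≤ p.2}.Infinite :=
  infinite_of_forall_solution_mem (A := 1) (B := 2) (C := 1) (x₀ := 0) (y₀ := 1) (a := 6)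
    (r := 3) (by norm_num) (by norm_num) (by norm_num) (by norm_num) (by norm_num)
    fun x y h => ⟨x, y, by linarith, rfl, rfl⟩

theorem infinite_family5 : {p ∈ family5 | p.1 ≤ p.2}.Infinite :=
  infinite_of_forall_solution_mem (A := 2) (B := 3) (C := 5) (x₀ := 1) (y₀ := 2) (a := 10)
    (r := 1) (by norm_num) (by norm_num) (by norm_num) (by norm_num) (by norm_num)
    fun x y h => ⟨x, y, h, rfl, by ring⟩

/-! ### Parallelograms in the plane -/

/-- The determinant of two plane vectors, that is, the signed area of the parallelogram they
span. -/
def planeDet (u v : Plane) : ℝ := u 0 * v 1 - u 1 * v 0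

theorem planeDet_swap (u v : Plane) : planeDet v u = -planeDet u v := by
  unfold planeDet
  ring

theorem planeDet_smul_sub_smul (α : ℝ) (e w : Plane) :
    planeDet (α • e) (w - α • e) = α * planeDet e w := by
  simp only [planeDet, PiLp.smul_apply, PiLp.sub_apply, smul_eq_mul]
  ring

theorem planeDet_add_right_self (e f : Plane) : planeDet e (e + f) = planeDet e f := by
  simp only [planeDet, PiLp.add_apply]
  ring

theorem abs_planeDet_of_inner_eq_zero {e f : Plane} (h : inner ℝ e f = (0 : ℝ)) :
    |planeDet e f| = ‖e‖ * ‖f‖ := by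
  have hsq : planeDet e f ^ 2 + inner ℝ e f ^ 2 = (‖e‖ * ‖f‖) ^ 2 := by
    rw [mul_pow, EuclideanSpace.real_norm_sq_eq, EuclideanSpace.real_norm_sq_eq]
    simp only [planeDet, PiLp.inner_apply, Fin.sum_univ_two, RCLike.inner_apply, conj_trivial]
    ring
  rw [h, zero_pow two_ne_zero, add_zero] at hsq
  rw [← abs_of_nonneg (by positivity : 0 ≤ ‖e‖ * ‖f‖)]
  exact (sq_eq_sq_iff_abs_eq_abs _ _).1 hsq

open MeasureTheory in
theorem volume_real_parallelepiped (u v : Plane) :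
    volume.real (parallelepiped ![u, v]) = |planeDet u v| := by
  rw [Measure.real, ← (EuclideanSpace.basisFun (Fin 2) ℝ).addHaar_eq_volume,
    Measure.addHaar_parallelepiped, ENNReal.toReal_ofReal (abs_nonneg _)]
  congr 1
  simp only [Module.Basis.det_apply, Matrix.det_fin_two, Module.Basis.toMatrix_apply,
    OrthonormalBasis.coe_toBasis_repr_apply, EuclideanSpace.basisFun_repr, Matrix.cons_val_zero,
    Matrix.cons_val_one, Matrix.cons_val_fin_one, planeDet]
  ring

section Parallelogram

variable {P R : Fin 4 → Plane} {a b : ℝ}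

theorem IsParallelogram.sub_eq_sub (h : IsParallelogram P) (i : Fin 4) :
    P (i + 1) - P i = P (i + 2) - P (i + 3) := by
  have h₀ : P 1 - P 0 = P 2 - P 3 := h.1
  have h₁ : P 2 - P 1 = P 3 - P 0 := by rw [sub_eq_sub_iff_sub_eq_sub, h₀]
  fin_cases i
  · exact h₀
  · exact h₁
  · change P 3 - P 2 = P 0 - P 1
    rw [← neg_sub, ← h₀, neg_sub]
  · change P 0 - P 3 = P 1 - P 2
    rw [← neg_sub, ← h₁, neg_sub]

theorem IsParallelogram.ne_succ (h : IsParallelogram P) (i : Fin 4) : P i ≠ P (i + 1) := by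
  have h₀ : P 1 - P 0 ≠ 0 := h.2.ne_zero 0
  have h₁ : P 3 - P 0 ≠ 0 := h.2.ne_zero 1
  rw [ne_comm, ← sub_ne_zero]
  fin_cases i
  · exact h₀
  · exact (h.sub_eq_sub 1).trans_ne h₁
  · exact (h.sub_eq_sub 2).trans_ne (sub_ne_zero.2 (sub_ne_zero.1 h₀).symm)
  · exact sub_ne_zero.2 (sub_ne_zero.1 h₁).symm

open Pointwise in
theorem IsParallelogram.range_eq (h : IsParallelogram P) (i : Fin 4) :
    Set.range P = {P i} + ({0, P (i + 1) - P i} + {0, P (i + 2) - P (i + 1)}) := by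
  have h₃ : P (i + 3) = P i + (P (i + 2) - P (i + 1)) := by
    linear_combination (norm := module) h.sub_eq_sub i
  have hrange : Set.range P = {P i, P (i + 1), P (i + 3), P (i + 2)} := by
    ext z
    constructor
    · rintro ⟨k, rfl⟩
      obtain ⟨l, rfl⟩ := (Equiv.addLeft i).surjective k
      fin_cases l <;> simp
    · rintro (rfl | rfl | rfl | rfl) <;> exact Set.mem_range_self _
  have h₂ : P i + (P (i + 1) - P i + (P (i + 2) - P (i + 1))) = P (i + 2) := by abel
  simp only [hrange, h₃, Set.insert_eq, Set.union_add, Set.add_union, Set.singleton_add_singleton,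
    Set.union_assoc, zero_add, add_zero, add_sub_cancel, h₂]

open MeasureTheory Pointwise in
theorem IsParallelogram.area_eq (h : IsParallelogram P) (i : Fin 4) :
    area P = |planeDet (P (i + 1) - P i) (P (i + 2) - P (i + 1))| := by
  have hhull : convexHull ℝ (Set.range P) =
      {P i} + parallelepiped ![P (i + 1) - P i, P (i + 2) - P (i + 1)] := by
    rw [h.range_eq i, convexHull_add, convexHull_singleton, parallelepiped_eq_convexHull,
      Fin.sum_univ_two]
    rfl
  rw [area, hhull, Set.singleton_add, Set.image_add_left, Measure.real, measure_preimage_add,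
    ← Measure.real, volume_real_parallelepiped]

theorem HasSides.symm (hs : HasSides P a b) : HasSides P b a :=
  Or.symm hs

theorem IsParallelogram.dist_eq_dist (h : IsParallelogram P) (i : Fin 4) :
    dist (P i) (P (i + 1)) = dist (P (i + 2)) (P (i + 3)) := by
  rw [dist_comm, dist_eq_norm, h.sub_eq_sub i, dist_eq_norm]

theorem IsParallelogram.perimeter_eq (h : IsParallelogram P) (hs : HasSides P a b) :
    perimeter P = 2 * (a + b) := by
  have h₂ : dist (P 2) (P 3) = dist (P 0) (P 1) := (h.dist_eq_dist 0).symm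
  have h₃ : dist (P 3) (P 0) = dist (P 1) (P 2) := (h.dist_eq_dist 1).symm
  have hsum : perimeter P =
      dist (P 0) (P 1) + dist (P 1) (P 2) + dist (P 2) (P 3) + dist (P 3) (P 0) :=
    Fin.sum_univ_four _
  rw [hsum, h₂, h₃]
  rcases hs with ⟨rfl, rfl⟩ | ⟨rfl, rfl⟩ <;> ring

theorem IsParallelogram.dist_eq_or (h : IsParallelogram P) (hs : HasSides P a b) (i : Fin 4) :
    dist (P i) (P (i + 1)) = a ∧ dist (P (i + 1)) (P (i + 2)) = b ∨
      dist (P i) (P (i + 1)) = b ∧ dist (P (i + 1)) (P (i + 2)) = a := by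
  have h₂ : dist (P 2) (P 3) = dist (P 0) (P 1) := (h.dist_eq_dist 0).symm
  have h₃ : dist (P 3) (P 0) = dist (P 1) (P 2) := (h.dist_eq_dist 1).symm
  fin_cases i
  · exact hs
  · exact hs.symm.imp (.imp_right h₂.trans ∘ And.symm) (.imp_right h₂.trans ∘ And.symm)
  · exact hs.imp (.imp h₂.trans h₃.trans) (.imp h₂.trans h₃.trans)
  · exact hs.symm.imp (.imp_left h₃.trans ∘ And.symm) (.imp_left h₃.trans ∘ And.symm)

theorem IsParallelogram.pos_and_pos (h : IsParallelogram P) (hs : HasSides P a b) :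
    0 < a ∧ 0 < b := by
  have h₀ : 0 < dist (P 0) (P 1) := dist_pos.2 (h.ne_succ 0)
  have h₁ : 0 < dist (P 1) (P 2) := dist_pos.2 (h.ne_succ 1)
  rcases hs with ⟨rfl, rfl⟩ | ⟨rfl, rfl⟩
  · exact ⟨h₀, h₁⟩
  · exact ⟨h₁, h₀⟩

theorem IsRectangle.inner_eq_zero (h : IsRectangle R) (j : Fin 4) :
    inner ℝ (R (j + 1) - R j) (R (j + 2) - R (j + 1)) = (0 : ℝ) := by
  have h₀ : R 2 - R 3 = R 1 - R 0 := (h.1.sub_eq_sub 0).symm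
  have h₁ : R 2 - R 1 = R 3 - R 0 := h.1.sub_eq_sub 1
  have hinner : inner ℝ (R 1 - R 0) (R 3 - R 0) = (0 : ℝ) := h.2
  fin_cases j
  · change inner ℝ (R 1 - R 0) (R 2 - R 1) = (0 : ℝ)
    rw [h₁, hinner]
  · change inner ℝ (R 2 - R 1) (R 3 - R 2) = (0 : ℝ)
    rw [h₁, ← neg_sub (R 2), h₀, inner_neg_right, real_inner_comm, hinner, neg_zero]
  · change inner ℝ (R 3 - R 2) (R 0 - R 3) = (0 : ℝ)
    rw [← neg_sub, h₀, ← neg_sub (R 3), inner_neg_neg, hinner]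
  · change inner ℝ (R 0 - R 3) (R 1 - R 0) = (0 : ℝ)
    rw [← neg_sub, inner_neg_left, real_inner_comm, hinner, neg_zero]

theorem IsParallelogram.exists_smul_of_mem_segment (h : IsParallelogram R) (j k : Fin 4) {x : Plane}
    (hx : x ∈ segment ℝ (R k) (R (k + 1))) :
    ∃ α : ℝ, 0 ≤ α ∧
      (x - R j = α • (R (j + 1) - R j) ∨ x - R j = α • (R (j + 2) - R (j + 1)) ∨
        R (j + 2) - x = α • (R (j + 1) - R j) ∨
        R (j + 2) - x = α • (R (j + 2) - R (j + 1))) := by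
  have hside : x ∈ segment ℝ (R j) (R (j + 1)) ∨ x ∈ segment ℝ (R (j + 1)) (R (j + 2)) ∨
      x ∈ segment ℝ (R (j + 2)) (R (j + 3)) ∨ x ∈ segment ℝ (R (j + 3)) (R j) := by
    obtain ⟨l, rfl⟩ := (Equiv.addLeft j).surjective k
    rw [Equiv.coe_addLeft, add_assoc] at hx
    fin_cases l
    · exact .inl (by simpa using hx)
    · exact .inr <| .inl hx
    · exact .inr <| .inr <| .inl hx
    · exact .inr <| .inr <| .inr (by simpa using hx)
  rcases hside with hx | hx | hx | hx <;> obtain ⟨α, β, hα, hβ, hαβ, rfl⟩ := hx <;>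
    obtain rfl : α = 1 - β := eq_sub_of_add_eq hαβ
  · exact ⟨β, hβ, .inl (by module)⟩
  · exact ⟨1 - β, hα, .inr <| .inr <| .inr (by module)⟩
  · exact ⟨β, hβ, .inr <| .inr <| .inl
      (by linear_combination (norm := module) (-β) • h.sub_eq_sub j)⟩
  · exact ⟨1 - β, hα, .inr <| .inl
      (by linear_combination (norm := module) (1 - β) • h.sub_eq_sub j)⟩

end Parallelogram

/-! ### Rectangles sharing a diagonal with a parallelogram -/

theorem exists_int_eq_of_sq_eq {a b : ℝ} {m n k : ℤ} (ha : a ^ 2 = m) (hb : b ^ 2 = n)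
    (hk : 2 * (a + b) = k) (h₀ : a + b ≠ 0) : ∃ z : ℤ, a = z := by
  by_contra hz
  refine irrational_nrt_of_notint_nrt 2 m ha hz two_pos ⟨(k / 2 + 2 * (m - n) / k) / 2, ?_⟩
  push_cast
  rw [← ha, ← hb, ← hk]
  field_simp
  ring

theorem IsLEP.exists_int_eq {P : Fin 4 → Plane} {a b : ℝ} (h : IsLEP P) (hs : HasSides P a b) :
    ∃ t : ℤ, a = t := by
  obtain ⟨hP, hlattice, hequable⟩ := h
  choose z hz using hlattice
  have hsq (i j : Fin 4) : ∃ m : ℤ, dist (P i) (P j) ^ 2 = m :=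
    ⟨(z i 0 - z j 0) ^ 2 + (z i 1 - z j 1) ^ 2, by
      simp [dist_eq_norm, EuclideanSpace.real_norm_sq_eq, Fin.sum_univ_two, hz]⟩
  obtain ⟨k, hk⟩ : ∃ k : ℤ, area P = k :=
    ⟨|(z 1 0 - z 0 0) * (z 2 1 - z 1 1) - (z 1 1 - z 0 1) * (z 2 0 - z 1 0)|, by
      simp [hP.area_eq 0, planeDet, hz]⟩
  obtain ⟨ha, hb⟩ := hP.pos_and_pos hs
  have hsum : 2 * (a + b) = k := by rw [← hP.perimeter_eq hs, hequable, hk]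
  obtain ⟨m, hm⟩ := hsq 0 1
  obtain ⟨n, hn⟩ := hsq 1 2
  rcases hs with ⟨rfl, rfl⟩ | ⟨rfl, rfl⟩
  · exact exists_int_eq_of_sq_eq hm hn hsum (by positivity)
  · exact exists_int_eq_of_sq_eq hn hm hsum (by positivity)

section SharedDiagonal

variable {u v e f : Plane} {α : ℝ} {a b m n : ℤ}

theorem isBaseSidePair_of_eq_smul (hα : 0 ≤ α) (hu : u = α • e) (huv : u + v = e + f)
    (hef : inner ℝ e f = (0 : ℝ)) (he : ‖e‖ = m) (hf : ‖f‖ = n) (ha : ‖u‖ = a) (hb : ‖v‖ = b)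
    (ha₀ : 0 < a) (hb₀ : 0 < b) (hdet : |planeDet u v| = 2 * (a + b)) : IsBaseSidePair a b := by
  obtain rfl : v = e + f - u := eq_sub_of_add_eq' huv
  subst hu
  have haα : α * m = a := by rw [← ha, norm_smul, Real.norm_of_nonneg hα, he]
  have hpyth : ((m - a : ℤ) : ℝ) ^ 2 + n ^ 2 = b ^ 2 := by
    have hsub : e + f - α • e = (1 - α) • e + f := by module
    rw [← hb, hsub, norm_add_sq_real, real_inner_smul_left, hef, norm_smul, he, hf, mul_pow,
      Real.norm_eq_abs, sq_abs]
    push_cast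
    rw [← haα]
    ring
  have harea : (a : ℝ) * n = 2 * (a + b) := by
    rw [← hdet, planeDet_smul_sub_smul, planeDet_add_right_self, abs_mul,
      abs_planeDet_of_inner_eq_zero hef, abs_of_nonneg hα, he, hf, ← haα, mul_assoc]
  refine ⟨ha₀, hb₀, m - a, n, ?_, by exact_mod_cast harea⟩
  simp only [PythagoreanTriple, ← sq]
  exact_mod_cast hpyth

theorem isBaseSidePair_or_of_eq_smul (hα : 0 ≤ α)
    (h : u = α • e ∨ u = α • f ∨ v = α • e ∨ v = α • f) (huv : u + v = e + f)
    (hef : inner ℝ e f = (0 : ℝ)) (he : ‖e‖ = m) (hf : ‖f‖ = n) (ha : ‖u‖ = a) (hb : ‖v‖ = b)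
    (ha₀ : 0 < a) (hb₀ : 0 < b) (hdet : |planeDet u v| = 2 * (a + b)) :
    IsBaseSidePair a b ∨ IsBaseSidePair b a := by
  have hfe : inner ℝ f e = (0 : ℝ) := by rw [real_inner_comm, hef]
  have huv' : u + v = f + e := by rw [huv, add_comm]
  have hdet' : |planeDet v u| = 2 * (b + a) := by rw [planeDet_swap, abs_neg, hdet, add_comm]
  rcases h with h | h | h | h
  · exact .inl (isBaseSidePair_of_eq_smul hα h huv hef he hf ha hb ha₀ hb₀ hdet)
  · exact .inl (isBaseSidePair_of_eq_smul hα h huv' hfe hf he ha hb ha₀ hb₀ hdet)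
  · rw [add_comm] at huv
    exact .inr (isBaseSidePair_of_eq_smul hα h huv hef he hf hb ha hb₀ ha₀ hdet')
  · rw [add_comm] at huv'
    exact .inr (isBaseSidePair_of_eq_smul hα h huv' hfe hf he hb ha hb₀ ha₀ hdet')

end SharedDiagonal

theorem IsPythagoreanLEP.exists_isBaseSidePair {P : Fin 4 → Plane} {a b : ℝ}
    (h : IsPythagoreanLEP P) (hs : HasSides P a b) :
    ∃ t c : ℤ, a = t ∧ b = c ∧ (IsBaseSidePair t c ∨ IsBaseSidePair c t) := by
  obtain ⟨hL, R, hR, hint, hcirc, i, j, hij, hij₂⟩ := h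
  have hP := hL.1
  obtain ⟨t, rfl⟩ := hL.exists_int_eq hs
  obtain ⟨c, rfl⟩ := hL.exists_int_eq hs.symm
  obtain ⟨ht, hc⟩ : 0 < t ∧ 0 < c := by exact_mod_cast hP.pos_and_pos hs
  refine ⟨t, c, rfl, rfl, ?_⟩
  obtain ⟨k, hk⟩ := hcirc (i + 1)
  obtain ⟨α, hα, hside⟩ := hR.1.exists_smul_of_mem_segment j k hk
  obtain ⟨m, hm⟩ := hint j
  obtain ⟨n, hn⟩ := hint (j + 1)
  rw [add_assoc] at hn
  rw [dist_comm, dist_eq_norm] at hm hn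
  have hdiag : P (i + 1) - P i + (P (i + 2) - P (i + 1)) =
      R (j + 1) - R j + (R (j + 2) - R (j + 1)) := by
    rw [hij, hij₂]
    abel
  have hdet : |planeDet (P (i + 1) - P i) (P (i + 2) - P (i + 1))| = 2 * (t + c) := by
    rw [← hP.area_eq, ← hL.2.2, hP.perimeter_eq hs]
  rcases hP.dist_eq_or hs i with ⟨ha, hb⟩ | ⟨ha, hb⟩ <;> rw [dist_comm, dist_eq_norm] at ha hb
  · exact isBaseSidePair_or_of_eq_smul hα (by rwa [hij, hij₂]) hdiag (hR.inner_eq_zero j) hm hn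
      ha hb ht hc hdet
  · exact (isBaseSidePair_or_of_eq_smul hα (by rwa [hij, hij₂]) hdiag (hR.inner_eq_zero j) hm hn
      ha hb hc ht (by rw [hdet, add_comm])).symm

/-- The parallelogram with a horizontal side of length `t` starting at the origin, whose other
side is the vector `(s, h)`. With `t + s` and `0` in place of `t` and `s` this is the rectangle
circumscribing it. -/
def cornerParallelogram (t s h : ℝ) : Fin 4 → Plane :=
  ![!₂[0, 0], !₂[t, 0], !₂[t + s, h], !₂[s, h]]

section Corner

variable {t s h : ℝ}

theorem isParallelogram_cornerParallelogram (ht : t ≠ 0) (hh : h ≠ 0) (s : ℝ) :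
    IsParallelogram (cornerParallelogram t s h) := by
  constructor
  · ext i
    fin_cases i <;> simp [cornerParallelogram]
  · refine LinearIndependent.pair_iff.2 fun x y hxy => ?_
    have hy : y = 0 := by
      simpa [cornerParallelogram, hh] using congrArg (fun w : Plane => w 1) hxy
    have hx : x = 0 := by
      simpa [cornerParallelogram, hy, ht] using congrArg (fun w : Plane => w 0) hxy
    exact ⟨hx, hy⟩

theorem isRectangle_cornerParallelogram (ht : t ≠ 0) (hh : h ≠ 0) :
    IsRectangle (cornerParallelogram t 0 h) :=
  ⟨isParallelogram_cornerParallelogram ht hh 0, by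
    simp [cornerParallelogram, PiLp.inner_apply, Fin.sum_univ_two]⟩

theorem hasSides_cornerParallelogram {r : ℝ} (ht : 0 ≤ t) (hr : 0 ≤ r)
    (hshr : s ^ 2 + h ^ 2 = r ^ 2) : HasSides (cornerParallelogram t s h) t r := by
  left
  constructor <;>
    simp [cornerParallelogram, EuclideanSpace.dist_eq, Fin.sum_univ_two, Real.dist_eq,
      Real.sqrt_sq, ht, hr, hshr]

theorem area_cornerParallelogram (ht : 0 < t) (hh : 0 < h) (s : ℝ) :
    area (cornerParallelogram t s h) = t * h := by
  rw [(isParallelogram_cornerParallelogram ht.ne' hh.ne' s).area_eq 0]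
  simp [cornerParallelogram, planeDet, abs_of_pos ht, abs_of_pos hh]

theorem mem_segment_of_mem_Icc {x l : ℝ} (hx : x ∈ Set.Icc 0 l) (y : ℝ) :
    (!₂[x, y] : Plane) ∈ segment ℝ !₂[0, y] !₂[l, y] := by
  rw [← segment_eq_Icc (hx.1.trans hx.2)] at hx
  obtain ⟨α, β, hα, hβ, hαβ, rfl⟩ := hx
  refine ⟨α, β, hα, hβ, hαβ, ?_⟩
  ext i
  fin_cases i
  · simp
  · simp [← add_mul, hαβ]

theorem circumscribes_cornerParallelogram (ht : 0 ≤ t) (hs : 0 ≤ s) (h : ℝ) :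
    Circumscribes (cornerParallelogram (t + s) 0 h) (cornerParallelogram t s h) := by
  intro i
  fin_cases i
  · exact ⟨0, left_mem_segment ..⟩
  · exact ⟨0, mem_segment_of_mem_Icc ⟨ht, by linarith⟩ 0⟩
  · exact ⟨1, by simp [cornerParallelogram, right_mem_segment]⟩
  · have htop := mem_segment_of_mem_Icc (l := t + s) ⟨hs, by linarith⟩ h
    exact ⟨2, by simpa [cornerParallelogram, segment_symm] using htop⟩

end Corner

theorem isLEP_cornerParallelogram {t s h c : ℤ} (ht : 0 < t) (hh : 0 < h) (hc : 0 ≤ c)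
    (hs : PythagoreanTriple s h c) (harea : t * h = 2 * (t + c)) :
    IsLEP (cornerParallelogram t s h) ∧ HasSides (cornerParallelogram t s h) t c := by
  have htR : (0 : ℝ) < t := by exact_mod_cast ht
  have hhR : (0 : ℝ) < h := by exact_mod_cast hh
  have hP := isParallelogram_cornerParallelogram htR.ne' hhR.ne' s
  have hpyth : (s : ℝ) ^ 2 + h ^ 2 = c ^ 2 := by
    simp only [PythagoreanTriple, ← sq] at hs
    exact_mod_cast hs
  have hsides := hasSides_cornerParallelogram htR.le (Int.cast_nonneg hc) hpyth
  refine ⟨⟨hP, fun i j => ?_, ?_⟩, hsides⟩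
  · fin_cases i <;> fin_cases j
    exacts [⟨0, Int.cast_zero.symm⟩, ⟨0, Int.cast_zero.symm⟩, ⟨t, rfl⟩, ⟨0, Int.cast_zero.symm⟩,
      ⟨t + s, (Int.cast_add t s).symm⟩, ⟨h, rfl⟩, ⟨s, rfl⟩, ⟨h, rfl⟩]
  · rw [hP.perimeter_eq hsides, area_cornerParallelogram htR hhR]
    exact_mod_cast harea.symm

theorem IsBaseSidePair.mem_pythagoreanSides {t c : ℤ} (h : IsBaseSidePair t c) :
    ((t : ℝ), (c : ℝ)) ∈ pythagoreanSides := by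
  obtain ⟨ht, hc, s, h, hs, harea⟩ := h
  have hh : 0 < h := pos_of_mul_pos_right (by rw [harea]; positivity) ht.le
  have hs' : PythagoreanTriple |s| h c := by
    rwa [PythagoreanTriple, abs_mul_abs_self]
  have htR : (0 : ℝ) < t := by exact_mod_cast ht
  have hsR : (0 : ℝ) ≤ (|s| : ℤ) := by exact_mod_cast abs_nonneg s
  have hhR : (0 : ℝ) < h := by exact_mod_cast hh
  obtain ⟨hP, hsides⟩ := isLEP_cornerParallelogram ht hh hc.le hs' harea
  have hR := isRectangle_cornerParallelogram (add_pos_of_pos_of_nonneg htR hsR).ne' hhR.ne'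
  refine ⟨_, ⟨hP, cornerParallelogram (t + (|s| : ℤ)) 0 h, hR, fun j => ?_,
    circumscribes_cornerParallelogram htR.le hsR h, 0, 0, rfl,
    by simp [cornerParallelogram]⟩, hsides⟩
  have hRsides := hasSides_cornerParallelogram (add_nonneg htR.le hsR) hhR.le
    (by ring : (0 : ℝ) ^ 2 + (h : ℝ) ^ 2 = h ^ 2)
  rcases hR.1.dist_eq_or hRsides j with ⟨hj, -⟩ | ⟨hj, -⟩
  · exact ⟨t + |s|, by rw [hj, Int.cast_add]⟩
  · exact ⟨h, hj⟩

theorem sideFamilies_subset_pythagoreanSides : sideFamilies ⊆ pythagoreanSides := by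
  rintro ⟨a, b⟩ h
  obtain ⟨t, c, rfl, rfl, hbase⟩ := exists_isBaseSidePair_of_mem_sideFamilies h
  exact hbase.mem_pythagoreanSides

theorem IsPythagoreanLEP.mem_sideFamilies {P : Fin 4 → Plane} {a b : ℝ} (h : IsPythagoreanLEP P)
    (hs : HasSides P a b) (hab : a ≤ b) : (a, b) ∈ sideFamilies := by
  obtain ⟨t, c, rfl, rfl, hbase | hbase⟩ := h.exists_isBaseSidePair hs
  · exact hbase.mem_sideFamilies
  · exact swap_mem_sideFamilies hbase.mem_sideFamilies hab

theorem fst_of_mem_sideFamilies {a b : ℝ} (h : (a, b) ∈ sideFamilies) :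
    a = 3 ∨ a = 4 ∨ a = 5 ∨ a = 6 ∨ a = 10 := by
  rcases h with ⟨_, _, _, rfl, _⟩ | ⟨_, _, _, rfl, _⟩ | ⟨_, _, _, rfl, _⟩ | ⟨_, _, _, rfl, _⟩ |
    ⟨_, _, _, rfl, _⟩ <;> simp

theorem theorem1p3 :
    -- the shorter side is 3, 4, 5, 6 or 10
    (∀ (P : Fin 4 → Plane) (a b : ℝ), IsPythagoreanLEP P → HasSides P a b → a ≤ b →
      a = 3 ∨ a = 4 ∨ a = 5 ∨ a = 6 ∨ a = 10) ∧
    -- the side pairs with `a ≤ b` are exactly those given by the five families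
    (∀ a b : ℝ, a ≤ b →
      ((a, b) ∈ pythagoreanSides ↔
        (a, b) ∈ family1 ∨ (a, b) ∈ family2 ∨ (a, b) ∈ family3 ∨ (a, b) ∈ family4 ∨
          (a, b) ∈ family5)) ∧
    -- every solution of each of the five equations gives a Pythagorean equable parallelogram
    (family1 ⊆ pythagoreanSides ∧ family2 ⊆ pythagoreanSides ∧ family3 ⊆ pythagoreanSides ∧
      family4 ⊆ pythagoreanSides ∧ family5 ⊆ pythagoreanSides) ∧
    -- each family is infinite, also after restriction to `a ≤ b`
    ({p ∈ family1 | p.1 ≤ p.2}.Infinite ∧ {p ∈ family2 | p.1 ≤ p.2}.Infinite ∧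
      {p ∈ family3 | p.1 ≤ p.2}.Infinite ∧ {p ∈ family4 | p.1 ≤ p.2}.Infinite ∧
      {p ∈ family5 | p.1 ≤ p.2}.Infinite) := by
  refine ⟨fun P a b hP hs hab => fst_of_mem_sideFamilies (hP.mem_sideFamilies hs hab),
    fun a b hab => ⟨fun ⟨P, hP, hs⟩ => hP.mem_sideFamilies hs hab,
      fun h => sideFamilies_subset_pythagoreanSides h⟩, ?_,
    infinite_family1, infinite_family2, infinite_family3, infinite_family4, infinite_family5⟩
  simpa only [sideFamilies, Set.union_subset_iff] using sideFamilies_subset_pythagoreanSides
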